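/- Let $d\ge N\ge 2$ be integers and endow $\mathbb R^N$ with its Euclidean structure. Let $\mathcal P^{m}(\mathbb R^N)$ be the space of real polynomials in $N$ variables of total degree at most $m$. A family of $d$ distinct hyperplanes $\ell_1,\dots,\ell_d$ of $\mathbb R^N$ is in general position if for every $N$-element subset $H\subset\{1,\dots,d\}$ the intersection $\bigcap_{i\in H}\ell_i$ is a single point $\vartheta_H$, and the map $H\mapsto\vartheta_H$ is one-to-one; the set $\Theta$ of all the points $\vartheta_H$ is then called the Chung–Yao lattice (of degree $d-N$) of the family. For every $s\in\mathbb N$ let $\ell^{(s)}_i=\{x\in\mathbb R^N:\langle \mathbf n^{(s)}_i,x\rangle-c^{(s)}_i=0\}$, $i=1,\dots,d$, with $\|\mathbf n^{(s)}_i\|=1$ and $c^{(s)}_i\in\mathbb R$, be a family of $d$ hyperplanes in general position, and let $\Theta^{(s)}$ be its Chung–Yao lattice. Assume: (C1) $\max\{\|\vartheta\|:\vartheta\in\Theta^{(s)}\}\to 0$ as $s\to\infty$; (C2) there is $\delta>0$ such that, for all $s\in\mathbb N$ and all $1\le i_1<\dots<i_N\le d$, the $N$-dimensional volume of the parallelotope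 spanned by $\mathbf n^{(s)}_{i_1},\dots,\mathbf n^{(s)}_{i_N}$ is at least $\delta$. Then every $\Theta^{(s)}$ is an interpolation lattice of degree $d-N$, that is, for every real function $f$ on $\Theta^{(s)}$ there is a unique polynomial $\mathbf L[\Theta^{(s)};f]\in\mathcal P^{d-N}(\mathbb R^N)$ that coincides with $f$ on $\Theta^{(s)}$. Moreover, for every function $f:\mathbb R^N\to\mathbb R$ that is of class $C^{d-N+1}$ on a neighborhood of the origin, $$\lim_{s\to\infty}\mathbf L[\Theta^{(s)};f]=\mathbf T_0^{d-N}(f),$$ where $\mathbf T_0^{d-N}(f)(x)=\sum_{k=0}^{d-N}\frac1{k!}D^kf(0)(x,\dots,x)$ is the Taylor polynomial of $f$ at $0$ to the order $d-N$, and the limit is taken in $\mathcal P^{d-N}(\mathbb R^N)$ with respect to any norm (equivalently, coefficientwise). -/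

import Mathlib

open MeasureTheory Filter Topology

noncomputable section

namespace ChungYao

/-- `ℝ^N` with its canonical Euclidean structure. -/
abbrev E (N : ℕ) : Type := EuclideanSpace ℝ (Fin N)

/-- The space of real polynomials in `N` variables of total degree at most `m`. -/
abbrev PolyLE (N m : ℕ) : Submodule ℝ (MvPolynomial (Fin N) ℝ) :=
  MvPolynomial.restrictTotalDegree (Fin N) ℝ m

/-- The value of a polynomial at a point of `ℝ^N`. -/
def evalAt {N m : ℕ} (P : PolyLE N m) (x : E N) : ℝ :=
  MvPolynomial.eval (fun i => x i) (P : MvPolynomial (Fin N) ℝ)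

/-- The hyperplane with equation `⟨n, x⟩ - c = 0`. -/
def hyperplane {N : ℕ} (n : E N) (c : ℝ) : Set (E N) :=
  {x | inner ℝ n x - c = 0}

/-- A family of `d` distinct hyperplanes of `ℝ^N` is in general position if any `N` of them meet
in exactly one point, and different `N`-subfamilies give different points. -/
structure InGeneralPosition {N d : ℕ} (ℓ : Fin d → Set (E N)) : Prop where
  distinct : Function.Injective ℓ
  singleton : ∀ H : Finset (Fin d), H.card = N → ∃ θ : E N, ⋂ i ∈ H, ℓ i = {θ}
  one_to_one : ∀ H H' : Finset (Fin d), H.card = N → H'.card = N →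
    ⋂ i ∈ H, ℓ i = ⋂ i ∈ H', ℓ i → H = H'

/-- The lattice of all the points at which `N` hyperplanes of the family meet. -/
def lattice {N d : ℕ} (ℓ : Fin d → Set (E N)) : Set (E N) :=
  {θ | ∃ H : Finset (Fin d), H.card = N ∧ ⋂ i ∈ H, ℓ i = {θ}}

/-- `A` is an interpolation lattice of degree `m`: every function on `A` is interpolated by exactly
one polynomial of degree at most `m`. -/
def IsInterpolationLattice {N : ℕ} (m : ℕ) (A : Set (E N)) : Prop :=
  ∀ f : E N → ℝ, ∃! P : PolyLE N m, ∀ a ∈ A, evalAt P a = f a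

/-- The Lagrange interpolation polynomial of `f` at an interpolation lattice `A` of degree `m`. -/
def lagrange {N m : ℕ} {A : Set (E N)} (hA : IsInterpolationLattice m A) (f : E N → ℝ) :
    PolyLE N m :=
  (hA f).choose

theorem lagrange_evalAt {N m : ℕ} {A : Set (E N)} (hA : IsInterpolationLattice m A)
    (f : E N → ℝ) {a : E N} (ha : a ∈ A) : evalAt (lagrange hA f) a = f a :=
  (hA f).choose_spec.1 a ha

/-- The Taylor polynomial of `f` at the origin to the order `m`,
`∑_{k ≤ m} (1 / k!) ∑_{j_1, …, j_k} D^k f(0)(e_{j_1}, …, e_{j_k}) X_{j_1} ⋯ X_{j_k}`. -/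
def taylorPoly {N : ℕ} (m : ℕ) (f : E N → ℝ) : MvPolynomial (Fin N) ℝ :=
  ∑ k ∈ Finset.range (m + 1), ∑ j : Fin k → Fin N,
    MvPolynomial.C ((k.factorial : ℝ)⁻¹ *
        iteratedFDeriv ℝ k f 0 (fun i => EuclideanSpace.single (j i) (1 : ℝ))) *
      ∏ i : Fin k, MvPolynomial.X (j i)

theorem taylorPoly_mem {N : ℕ} (m : ℕ) (f : E N → ℝ) : taylorPoly m f ∈ PolyLE N m := by
  refine Submodule.sum_mem _ fun k hk => Submodule.sum_mem _ fun j _ => ?_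
  rw [MvPolynomial.mem_restrictTotalDegree]
  refine (MvPolynomial.totalDegree_mul _ _).trans ?_
  rw [MvPolynomial.totalDegree_C, zero_add]
  refine (MvPolynomial.totalDegree_finsetProd _ _).trans ?_
  have hk' := Finset.mem_range.1 hk
  simp
  omega

/-- The Taylor polynomial as an element of the space of polynomials of degree at most `m`. -/
def taylor {N : ℕ} (m : ℕ) (f : E N → ℝ) : PolyLE N m :=
  ⟨taylorPoly m f, taylorPoly_mem m f⟩

/-- The value of the Taylor polynomial is `∑_{k ≤ m} (1 / k!) D^k f(0)(x, …, x)`. -/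
theorem taylor_evalAt {N : ℕ} (m : ℕ) (f : E N → ℝ) (x : E N) :
    evalAt (taylor m f) x =
      ∑ k ∈ Finset.range (m + 1), (k.factorial : ℝ)⁻¹ * iteratedFDeriv ℝ k f 0 (fun _ => x) := by
  have hx : x = ∑ i, x i • EuclideanSpace.single i (1 : ℝ) := by
    ext k
    simp [Finset.sum_apply, Pi.single_apply]
  have key : ∀ k : ℕ, iteratedFDeriv ℝ k f 0 (fun _ => x) =
      ∑ j : Fin k → Fin N, (∏ i, x (j i)) *
        iteratedFDeriv ℝ k f 0 (fun i => EuclideanSpace.single (j i) (1 : ℝ)) := by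
    intro k
    conv_lhs => rw [hx]
    rw [ContinuousMultilinearMap.map_sum]
    refine Finset.sum_congr rfl fun j _ => ?_
    rw [ContinuousMultilinearMap.map_smul_univ, smul_eq_mul]
  simp only [evalAt, taylor, taylorPoly, map_sum, map_mul, map_prod, MvPolynomial.eval_C,
    MvPolynomial.eval_X]
  refine Finset.sum_congr rfl fun k _ => ?_
  rw [key, Finset.mul_sum]
  refine Finset.sum_congr rfl fun j _ => ?_
  ring

end ChungYao

end

/-! Unisolvence is a dimension count: the products of the affine forms outside `H` give fundamental
polynomials, so evaluation at the `d.choose N` vertices is onto, and the polynomial space has at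
most that dimension.

For the limit, subtract the Taylor polynomial, which interpolation reproduces. It remains to see
that the interpolants tend to zero for a function `g` whose diagonal derivatives at the origin
vanish up to order `d - N`. These interpolants are built à la Newton, adding one hyperplane `a` at a
time to a subfamily `S` of `N + k` hyperplanes (`newton_evalAt_eq`, `exists_tendsto_zero`). Each
correction coefficient belongs to a line cut out by `N - 1` hyperplanes `K ⊆ S`: it is the error at
the vertex of `insert a K` divided by the product of the forms of `S \ K` there.

On that line the old interpolant has degree at most `k` and matches `g` at `k + 1` vertices, so the
error is a derivative of order `k + 1` times a product of line parameters. By (C2) the line is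
uniformly transversal to the hyperplanes of `S \ K`, so this product is at most `1 / δ ^ (k + 1)`
times the product of the forms (`abs_sub_evalAt_le`). The small denominators thus cancel although
the vertices coalesce, and the coefficients tend to zero with the derivatives of `g`. -/

namespace ChungYao

/-! ### Interpolation error in one variable -/

/-- **Iterated Rolle theorem**: if `F 0` has `k + 1` zeros in a convex set, then `F k`, its `k`-th
derivative, has a zero there. -/
theorem exists_iterated_deriv_eq_zero {I : Set ℝ} (hI : I.OrdConnected) (k : ℕ) (F : ℕ → ℝ → ℝ)
    (hF : ∀ j < k, ∀ t ∈ I, HasDerivAt (F j) (F (j + 1) t) t)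
    (Z : Finset ℝ) (hZ : Z.card = k + 1) (hZI : ∀ z ∈ Z, z ∈ I) (hz : ∀ z ∈ Z, F 0 z = 0) :
    ∃ ξ ∈ I, F k ξ = 0 := by
  induction k generalizing F Z with
  | zero =>
    obtain ⟨z, hzZ⟩ := Finset.card_pos.1 (by omega : 0 < Z.card)
    exact ⟨z, hZI z hzZ, hz z hzZ⟩
  | succ k ih =>
    let e := Z.orderEmbOfFin hZ
    have heZ : ∀ i, e i ∈ Z := fun i => Z.orderEmbOfFin_mem hZ i
    have hroot : ∀ i : Fin (k + 1), ∃ y ∈ Set.Ioo (e i.castSucc) (e i.succ), F 1 y = 0 := by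
      intro i
      have hsub : Set.Icc (e i.castSucc) (e i.succ) ⊆ I :=
        hI.out (hZI _ (heZ _)) (hZI _ (heZ _))
      refine exists_hasDerivAt_eq_zero (f := F 0) (e.strictMono i.castSucc_lt_succ)
        (fun t ht => (hF 0 (by omega) t (hsub ht)).continuousAt.continuousWithinAt) ?_
        (fun t ht => hF 0 (by omega) t (hsub (Set.Ioo_subset_Icc_self ht)))
      rw [hz _ (heZ _), hz _ (heZ _)]
    choose y hy hy0 using hroot
    -- The gaps between consecutive zeros are disjoint, so the new zeros are distinct.
    have hmono : StrictMono y := by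
      intro i j hij
      calc y i < e i.succ := (hy i).2
        _ ≤ e j.castSucc := e.monotone (by
            rw [Fin.le_def]; simp; exact hij)
        _ < y j := (hy j).1
    have hyI : ∀ i, y i ∈ I := fun i =>
      hI.out (hZI _ (heZ _)) (hZI _ (heZ _)) (Set.Ioo_subset_Icc_self (hy i))
    refine ih (fun j => F (j + 1)) (fun j hj t ht => hF (j + 1) (by omega) t ht)
      (Finset.univ.map ⟨y, hmono.injective⟩) (by simp) ?_ ?_
    · simpa using hyI
    · simpa using hy0

open Polynomial in
/-- The error of Lagrange interpolation in one variable at `k` nodes, evaluated at the origin. -/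
theorem exists_interpolation_error {I : Set ℝ} (hI : I.OrdConnected) (k : ℕ) (F : ℕ → ℝ → ℝ)
    (hF : ∀ j < k, ∀ t ∈ I, HasDerivAt (F j) (F (j + 1) t) t)
    (Z : Finset ℝ) (hZ : Z.card = k) (hZI : ∀ z ∈ Z, z ∈ I) (h0 : (0 : ℝ) ∈ I) (h0Z : (0 : ℝ) ∉ Z)
    (q : ℝ[X]) (hq : q.natDegree < k) (hqZ : ∀ z ∈ Z, F 0 z = q.eval z) :
    ∃ ξ ∈ I, F 0 0 - q.eval 0 = F k ξ / k.factorial * ∏ z ∈ Z, (-z) := by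
  classical
  set W : ℝ[X] := ∏ z ∈ Z, (X - C z) with hW
  have hWm : W.Monic := monic_prod_of_monic _ _ fun z _ => monic_X_sub_C z
  have hWdeg : W.natDegree = k := by
    rw [hW, natDegree_prod_of_monic _ _ fun z _ => monic_X_sub_C z]
    simp [hZ]
  have hW0 : W.eval 0 = ∏ z ∈ Z, (-z) := by simp [hW, eval_prod]
  have hW0' : W.eval 0 ≠ 0 := by
    rw [hW0]
    exact Finset.prod_ne_zero_iff.2 fun z hz => neg_ne_zero.2 (ne_of_mem_of_not_mem hz h0Z)
  have hWZ : ∀ z ∈ Z, W.eval z = 0 := fun z hz => by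
    rw [hW, eval_prod]
    exact Finset.prod_eq_zero hz (by simp)
  -- `A` makes `F 0 - q - A * W` vanish at the origin as well as on `Z`: `k + 1` zeros. Its `k`-th
  -- derivative is `F k - A * k!`.
  set A : ℝ := (F 0 0 - q.eval 0) / W.eval 0 with hA
  have hWk : derivative^[k] W = C (k.factorial : ℝ) := by
    have hlt : (derivative^[k] W).natDegree ≤ 0 := by
      have := natDegree_iterate_derivative W k
      omega
    rw [eq_C_of_natDegree_le_zero hlt, coeff_iterate_derivative]
    have : W.coeff (0 + k) = 1 := by
      rw [zero_add, ← hWdeg]; exact hWm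
    rw [this]
    simp [Nat.descFactorial_self]
  have hQk : derivative^[k] (q + C A * W) = C (A * k.factorial) := by
    rw [iterate_map_add, iterate_derivative_eq_zero hq, iterate_derivative_C_mul, hWk]
    simp
  obtain ⟨ξ, hξ, hξ0⟩ := exists_iterated_deriv_eq_zero hI k
    (fun j t => F j t - (derivative^[j] (q + C A * W)).eval t)
    (fun j hj t ht => by
      rw [Function.iterate_succ_apply']
      exact (hF j hj t ht).sub (Polynomial.hasDerivAt _ t))
    (insert 0 Z) (by simp [h0Z, hZ])
    (by simpa using ⟨h0, hZI⟩)
    (by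
      intro z hz
      rcases Finset.mem_insert.1 hz with rfl | hz
      · simp [hA, div_mul_cancel₀ _ hW0']
      · simp [hWZ z hz, hqZ z hz])
  refine ⟨ξ, hξ, ?_⟩
  simp only [hQk, eval_C] at hξ0
  have hk : (k.factorial : ℝ) ≠ 0 := by positivity
  rw [← hW0, sub_eq_zero.1 hξ0, mul_div_cancel_right₀ _ hk, hA, div_mul_cancel₀ _ hW0']

/-- The derivative along a line of an iterated directional derivative. -/
theorem hasDerivAt_iteratedFDeriv_line {E : Type*} [NormedAddCommGroup E] [NormedSpace ℝ E]
    {g : E → ℝ} {k j : ℕ} (hj : j < k) {x v : E} {t : ℝ} (hg : ContDiffAt ℝ k g (x + t • v)) :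
    HasDerivAt (fun t : ℝ => iteratedFDeriv ℝ j g (x + t • v) (fun _ => v))
      (iteratedFDeriv ℝ (j + 1) g (x + t • v) (fun _ => v)) t := by
  have hd : DifferentiableAt ℝ (iteratedFDeriv ℝ j g) (x + t • v) :=
    hg.differentiableAt_iteratedFDeriv (by exact_mod_cast hj)
  have hl : HasDerivAt (fun t : ℝ => x + t • v) v t := by
    simpa using ((hasDerivAt_id t).smul_const v).const_add x
  have h1 := hd.hasFDerivAt.comp_hasDerivAt t hl
  have h2 := (ContinuousMultilinearMap.apply ℝ (fun _ : Fin j => E) ℝ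
    (fun _ => v)).hasFDerivAt.comp_hasDerivAt t h1
  rw [iteratedFDeriv_succ_apply_left]
  exact h2

/-! ### Uniform transversality from the volume condition -/

/-- Given unit vectors `u_1, …, u_M` of `ℝ^(M+1)`, their cross product is a vector of norm at most
one, orthogonal to each of them, whose inner products are volumes of parallelotopes. -/
theorem exists_crossProduct {M : ℕ} (u : Fin M → E (M + 1)) (hu : ∀ i, ‖u i‖ = 1) :
    ∃ v : E (M + 1), ‖v‖ ≤ 1 ∧ (∀ i, inner ℝ (u i) v = 0) ∧
      ∀ w, |inner ℝ w v| =
        (volume : Measure (E (M + 1))).real (parallelepiped (Fin.cons w u : Fin (M + 1) → E (M + 1))) := by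
  have : Fact (Module.finrank ℝ (E (M + 1)) = M + 1) := ⟨by simp⟩
  let o : Orientation ℝ (E (M + 1)) (Fin (M + 1)) :=
    (EuclideanSpace.basisFun (Fin (M + 1)) ℝ).toBasis.orientation
  let φ : E (M + 1) →ₗ[ℝ] ℝ :=
    { toFun := fun w => o.volumeForm (Fin.cons w u : Fin (M + 1) → E (M + 1))
      map_add' := fun x y => by
        simpa using (o.volumeForm.toMultilinearMap.cons_add u x y)
      map_smul' := fun r x => by
        simpa using (o.volumeForm.toMultilinearMap.cons_smul u r x) }
  -- Riesz representative of `w ↦ det (w, u_1, …, u_M)`.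
  let v := (InnerProductSpace.toDual ℝ (E (M + 1))).symm (LinearMap.toContinuousLinearMap φ)
  have hv : ∀ w, inner ℝ w v = o.volumeForm (Fin.cons w u : Fin (M + 1) → E (M + 1)) := fun w => by
    rw [real_inner_comm]
    exact InnerProductSpace.toDual_symm_apply
  have hle : ∀ w, |inner ℝ w v| ≤ ‖w‖ := fun w => by
    rw [hv]
    refine (o.abs_volumeForm_apply_le _).trans ?_
    simp [Fin.prod_univ_succ, hu]
  refine ⟨v, ?_, fun i => ?_, fun w => ?_⟩
  · have h := hle v
    rw [real_inner_self_eq_norm_sq, abs_of_nonneg (by positivity)] at h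
    by_contra! hlt
    nlinarith
  · rw [hv]
    exact o.volumeForm.map_eq_zero_of_eq _ (i := 0) (j := i.succ) (by simp) (Fin.succ_ne_zero i).symm
  · rw [hv, ← o.measure_eq_volume, Measure.real, AlternatingMap.measure_parallelepiped,
      ENNReal.toReal_ofReal (abs_nonneg _)]

/-- A lower bound on the volumes of the parallelotopes spanned by increasing subfamilies holds for
all injective subfamilies. -/
theorem le_volume_of_injective {N d : ℕ} {n : Fin d → E N} {δ : ℝ}
    (h : ∀ i : Fin N → Fin d, StrictMono i →
      δ ≤ (volume : Measure (E N)).real (parallelepiped (fun k => n (i k))))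
    (i : Fin N → Fin d) (hi : Function.Injective i) :
    δ ≤ (volume : Measure (E N)).real (parallelepiped (fun k => n (i k))) := by
  -- Sorting the indices does not change the parallelotope.
  have hm : StrictMono (i ∘ Tuple.sort i) :=
    (Tuple.monotone_sort i).strictMono_of_injective (hi.comp (Tuple.sort i).injective)
  have := h _ hm
  rwa [show (fun k => n ((i ∘ Tuple.sort i) k)) = (fun k => n (i k)) ∘ (Tuple.sort i) from rfl,
    parallelepiped_comp_equiv] at this

/-- The line cut out by `N - 1` hyperplanes has a direction vector of norm at most one that is
uniformly transversal to the other hyperplanes. -/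
theorem exists_direction {N d : ℕ} {n : Fin d → E N} (hn : ∀ i, ‖n i‖ = 1) {δ : ℝ}
    (h : ∀ i : Fin N → Fin d, StrictMono i →
      δ ≤ (volume : Measure (E N)).real (parallelepiped (fun k => n (i k))))
    (K : Finset (Fin d)) (hK : K.card + 1 = N) :
    ∃ v : E N, ‖v‖ ≤ 1 ∧ (∀ i ∈ K, inner ℝ (n i) v = 0) ∧ ∀ i ∉ K, δ ≤ |inner ℝ (n i) v| := by
  obtain ⟨M, rfl⟩ : ∃ M, N = M + 1 := ⟨K.card, hK.symm⟩
  have hKM : K.card = M := by omega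
  let e := K.orderEmbOfFin hKM
  obtain ⟨v, hv, hv0, hvol⟩ := exists_crossProduct (fun k => n (e k)) (fun k => hn _)
  refine ⟨v, hv, fun i hi => ?_, fun i hi => ?_⟩
  · have : i ∈ Set.range e := by rw [Finset.range_orderEmbOfFin]; exact hi
    obtain ⟨k, rfl⟩ := this
    exact hv0 k
  · have hinj : Function.Injective (Fin.cons i (fun k => e k) : Fin (M + 1) → Fin d) := by
      rw [Fin.cons_injective_iff]
      refine ⟨?_, e.injective⟩
      rintro ⟨k, rfl⟩
      exact hi (K.orderEmbOfFin_mem hKM k)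
    have := le_volume_of_injective h _ hinj
    rw [hvol]
    convert this using 3
    funext k
    refine Fin.cases ?_ (fun k => ?_) k <;> simp

end ChungYao

noncomputable section

namespace ChungYao

/-! ### Dimension of the polynomial space and products of affine forms -/

/-- The space of polynomials of degree at most `m` has dimension at most `(N + m).choose N`. -/
theorem finrank_polyLE_le (N m : ℕ) : Module.finrank ℝ (PolyLE N m) ≤ (N + m).choose N := by
  classical
  let s : Set (Fin N →₀ ℕ) := {n | (n.sum fun _ e => e) ≤ m}
  -- Stars and bars: an exponent is homogenized to degree `m` by copies of `none`.
  let φ : s → Sym (Option (Fin N)) m := fun a =>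
    ⟨(Finsupp.toMultiset a.1).map some + Multiset.replicate (m - a.1.sum fun _ e => e) none, by
      have h : (a.1.sum fun _ e => e) ≤ m := a.2
      rw [Multiset.card_add, Multiset.card_map, Multiset.card_replicate, Finsupp.card_toMultiset]
      exact Nat.add_sub_cancel' h⟩
  have hφ : Function.Injective φ := by
    intro a b hab
    apply Subtype.ext
    ext i
    have h := congrArg (fun z : Sym (Option (Fin N)) m => (z : Multiset _).count (some i)) hab
    simpa [φ, Multiset.count_map_eq_count' _ _ (Option.some_injective _),
      Multiset.count_replicate] using h
  have : Fintype s := Fintype.ofInjective φ hφ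
  have hb := Module.finrank_eq_card_basis (MvPolynomial.basisRestrictSupport ℝ s)
  have hc := Fintype.card_le_of_injective φ hφ
  rw [Sym.card_sym_eq_choose, Fintype.card_option, Fintype.card_fin,
    show N + 1 + m - 1 = N + m by omega, ← Nat.choose_symm_add] at hc
  exact hb.trans_le hc

/-- Evaluation at a point as a linear map. -/
def evalₗ (N m : ℕ) (x : E N) : PolyLE N m →ₗ[ℝ] ℝ :=
  (MvPolynomial.aeval (fun i => x i)).toLinearMap ∘ₗ (PolyLE N m).subtype

theorem evalₗ_apply {N m : ℕ} (x : E N) (P : PolyLE N m) : evalₗ N m x P = evalAt P x := by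
  simp [evalₗ, evalAt]

/-- The polynomial `⟨n, x⟩ - c`. -/
def affineForm {N : ℕ} (n : E N) (c : ℝ) : MvPolynomial (Fin N) ℝ :=
  ∑ i, MvPolynomial.C (n i) * MvPolynomial.X i - MvPolynomial.C c

theorem eval_affineForm {N : ℕ} (n : E N) (c : ℝ) (x : E N) :
    MvPolynomial.eval (fun i => x i) (affineForm n c) = inner ℝ n x - c := by
  simp [affineForm, PiLp.inner_apply, mul_comm]

theorem totalDegree_affineForm_le {N : ℕ} (n : E N) (c : ℝ) :
    (affineForm n c).totalDegree ≤ 1 := by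
  refine (MvPolynomial.totalDegree_sub_C_le _ _).trans ?_
  refine MvPolynomial.totalDegree_finsetSum_le fun i _ => ?_
  refine (MvPolynomial.totalDegree_mul _ _).trans ?_
  simp

/-- The product of the affine forms with indices in `A`. -/
def formProd {N d : ℕ} (n : Fin d → E N) (c : Fin d → ℝ) (A : Finset (Fin d)) :
    MvPolynomial (Fin N) ℝ :=
  ∏ i ∈ A, affineForm (n i) (c i)

theorem eval_formProd {N d : ℕ} (n : Fin d → E N) (c : Fin d → ℝ) (A : Finset (Fin d)) (x : E N) :
    MvPolynomial.eval (fun i => x i) (formProd n c A) = ∏ i ∈ A, (inner ℝ (n i) x - c i) := by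
  simp [formProd, map_prod, eval_affineForm]

theorem formProd_mem {N d m : ℕ} (n : Fin d → E N) (c : Fin d → ℝ) (A : Finset (Fin d))
    (hA : A.card ≤ m) : formProd n c A ∈ PolyLE N m := by
  rw [MvPolynomial.mem_restrictTotalDegree]
  refine (MvPolynomial.totalDegree_finsetProd _ _).trans ?_
  refine (Finset.sum_le_card_nsmul _ _ 1 fun i _ => totalDegree_affineForm_le _ _).trans ?_
  simpa using hA

/-! ### Vertices and unisolvence -/

/-- `θ H` is the intersection point of the hyperplanes with indices in the `N`-subset `H`, and it
lies on no other hyperplane. -/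
structure IsVertexMap {N d : ℕ} (n : Fin d → E N) (c : Fin d → ℝ)
    (θ : Finset (Fin d) → E N) : Prop where
  mem_iff : ∀ H : Finset (Fin d), H.card = N → ∀ x, (∀ i ∈ H, inner ℝ (n i) x - c i = 0) ↔ x = θ H
  ne_zero : ∀ H : Finset (Fin d), H.card = N → ∀ i ∉ H, inner ℝ (n i) (θ H) - c i ≠ 0

/-- Exchange argument: if a hyperplane `i ∉ H` passed through `θ H`, replacing some `a ∈ H` by `i`
would give another `N`-subset with the same vertex, against `one_to_one`. -/
theorem InGeneralPosition.exists_isVertexMap {N d : ℕ} (hN : 0 < N) {n : Fin d → E N}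
    {c : Fin d → ℝ} (h : InGeneralPosition (fun i => hyperplane (n i) (c i))) :
    ∃ θ : Finset (Fin d) → E N, IsVertexMap n c θ ∧
      ∀ H : Finset (Fin d), H.card = N → ⋂ i ∈ H, hyperplane (n i) (c i) = {θ H} := by
  classical
  choose! θ hθ using h.singleton
  have hmem : ∀ H : Finset (Fin d), H.card = N →
      ∀ x, (∀ i ∈ H, inner ℝ (n i) x - c i = 0) ↔ x = θ H := fun H hH x => by
    have : x ∈ ⋂ i ∈ H, hyperplane (n i) (c i) ↔ x = θ H := by rw [hθ H hH]; rfl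
    simpa [hyperplane] using this
  refine ⟨θ, ⟨hmem, fun H hH i hi h0 => ?_⟩, hθ⟩
  obtain ⟨a, ha⟩ := Finset.card_pos.1 (hH.symm ▸ hN : 0 < H.card)
  have hcard : (insert i (H.erase a)).card = N := by
    rw [Finset.card_insert_of_notMem (fun hm => hi (Finset.mem_of_mem_erase hm)),
      Finset.card_erase_of_mem ha]
    omega
  have hx : θ H = θ (insert i (H.erase a)) := by
    rw [← hmem _ hcard]
    intro j hj
    rcases Finset.mem_insert.1 hj with rfl | hj
    · exact h0
    · exact (hmem H hH _).2 rfl j (Finset.mem_of_mem_erase hj)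
  have := h.one_to_one H _ hH hcard (by rw [hθ H hH, hθ _ hcard, hx])
  exact hi (this ▸ Finset.mem_insert_self _ _)

theorem lattice_eq_image {N d : ℕ} {n : Fin d → E N} {c : Fin d → ℝ} {θ : Finset (Fin d) → E N}
    (hθ : ∀ H : Finset (Fin d), H.card = N → ⋂ i ∈ H, hyperplane (n i) (c i) = {θ H}) :
    lattice (fun i => hyperplane (n i) (c i)) = θ '' {H | H.card = N} := by
  ext x
  constructor
  · rintro ⟨H, hH, hx⟩
    rw [hθ H hH] at hx
    exact ⟨H, hH, Set.singleton_injective hx⟩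
  · rintro ⟨H, hH, rfl⟩
    exact ⟨H, hH, hθ H hH⟩

namespace IsVertexMap

variable {N d : ℕ} {n : Fin d → E N} {c : Fin d → ℝ} {θ : Finset (Fin d) → E N}

theorem apply_eq_zero (h : IsVertexMap n c θ) {H : Finset (Fin d)} (hH : H.card = N) {i : Fin d}
    (hi : i ∈ H) : inner ℝ (n i) (θ H) - c i = 0 :=
  (h.mem_iff H hH _).2 rfl i hi

/-- A product of affine forms vanishes at `θ H` as soon as one of its factors has index in `H`. -/
theorem prod_eq_zero (h : IsVertexMap n c θ) {H A : Finset (Fin d)} (hH : H.card = N)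
    {i : Fin d} (hi : i ∈ H) (hiA : i ∈ A) : ∏ i ∈ A, (inner ℝ (n i) (θ H) - c i) = 0 :=
  Finset.prod_eq_zero hiA (h.apply_eq_zero hH hi)

theorem prod_ne_zero (h : IsVertexMap n c θ) {H A : Finset (Fin d)} (hH : H.card = N)
    (hA : Disjoint A H) : ∏ i ∈ A, (inner ℝ (n i) (θ H) - c i) ≠ 0 :=
  Finset.prod_ne_zero_iff.2 fun i hi => h.ne_zero H hH i (Finset.disjoint_left.1 hA hi)

/-- The fundamental Lagrange polynomials of a Chung–Yao lattice. -/
theorem exists_fundamental (h : IsVertexMap n c θ) :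
    ∃ L : Finset (Fin d) → PolyLE N (d - N), ∀ H H' : Finset (Fin d), H.card = N → H'.card = N →
      evalAt (L H) (θ H') = if H = H' then 1 else 0 := by
  classical
  have key : ∀ H : Finset (Fin d), ∃ L : PolyLE N (d - N), H.card = N →
      ∀ H' : Finset (Fin d), H'.card = N → evalAt L (θ H') = if H = H' then 1 else 0 := by
    intro H
    by_cases hH : H.card = N
    swap
    · exact ⟨0, fun h' => absurd h' hH⟩
    -- Any other `N`-subset meets `Hᶜ`, so the product vanishes at its vertex.
    refine ⟨(∏ i ∈ Hᶜ, (inner ℝ (n i) (θ H) - c i))⁻¹ •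
      ⟨formProd n c Hᶜ, formProd_mem n c _ (by rw [Finset.card_compl, hH]; simp)⟩, fun _ H' hH' => ?_⟩
    rw [← evalₗ_apply, map_smul, evalₗ_apply, evalAt, eval_formProd, smul_eq_mul]
    split_ifs with heq
    · subst heq
      exact inv_mul_cancel₀ (h.prod_ne_zero hH disjoint_compl_left)
    · obtain ⟨i, hi, hiH⟩ : ∃ i ∈ H', i ∉ H := by
        by_contra! hsub
        exact heq (Finset.eq_of_subset_of_card_le hsub (by omega)).symm
      rw [h.prod_eq_zero hH' hi (Finset.mem_compl.2 hiH), mul_zero]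
  choose L hL using key
  exact ⟨L, fun H H' hH hH' => hL H hH H' hH'⟩

/-- Evaluation at the vertices is injective on polynomials of degree at most `d - N`. -/
theorem eq_zero_of_evalAt_eq_zero (h : IsVertexMap n c θ) (hd : N ≤ d) (P : PolyLE N (d - N))
    (hP : ∀ H : Finset (Fin d), H.card = N → evalAt P (θ H) = 0) : P = 0 := by
  classical
  obtain ⟨L, hL⟩ := h.exists_fundamental
  let Φ : PolyLE N (d - N) →ₗ[ℝ] ({H : Finset (Fin d) // H.card = N} → ℝ) :=
    LinearMap.pi fun H => evalₗ N (d - N) (θ H.1)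
  have hsurj : Function.Surjective Φ := by
    intro φ
    refine ⟨∑ H : {H : Finset (Fin d) // H.card = N}, φ H • L H.1, ?_⟩
    funext H'
    simp only [Φ, LinearMap.pi_apply, map_sum, map_smul, evalₗ_apply, smul_eq_mul]
    rw [Finset.sum_eq_single H']
    · simp [hL _ _ H'.2 H'.2]
    · intro H _ hne
      rw [hL _ _ H.2 H'.2, if_neg (fun he => hne (Subtype.ext he)), mul_zero]
    · simp
  have hker : LinearMap.ker Φ = ⊥ := by
    have hrank := LinearMap.finrank_range_add_finrank_ker Φ
    rw [LinearMap.range_eq_top.2 hsurj, finrank_top, Module.finrank_fintype_fun_eq_card,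
      Fintype.card_finset_len, Fintype.card_fin] at hrank
    have hle := finrank_polyLE_le N (d - N)
    rw [Nat.add_sub_cancel' hd] at hle
    exact Submodule.finrank_eq_zero.1 (by omega)
  have : P ∈ LinearMap.ker Φ := by
    rw [LinearMap.mem_ker]
    funext H
    simpa [Φ, evalₗ_apply] using hP H.1 H.2
  rwa [hker, Submodule.mem_bot] at this

/-- Two polynomials of degree at most `d - N` with the same values at the vertices are equal. -/
theorem eq_of_evalAt_eq (h : IsVertexMap n c θ) (hd : N ≤ d) {P Q : PolyLE N (d - N)}
    (hPQ : ∀ H : Finset (Fin d), H.card = N → evalAt P (θ H) = evalAt Q (θ H)) : P = Q := by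
  rw [← sub_eq_zero]
  refine h.eq_zero_of_evalAt_eq_zero hd _ fun H hH => ?_
  rw [← evalₗ_apply, map_sub, evalₗ_apply, evalₗ_apply, hPQ H hH, sub_self]

/-- The Lagrange interpolation formula. -/
theorem exists_eq_sum (h : IsVertexMap n c θ) :
    ∃ L : Finset (Fin d) → PolyLE N (d - N), ∀ φ : Finset (Fin d) → ℝ, ∀ H : Finset (Fin d),
      H.card = N → evalAt (∑ H ∈ Finset.univ.powersetCard N, φ H • L H) (θ H) = φ H := by
  classical
  obtain ⟨L, hL⟩ := h.exists_fundamental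
  refine ⟨L, fun φ H hH => ?_⟩
  rw [← evalₗ_apply, map_sum, Finset.sum_eq_single H]
  · simp [evalₗ_apply, hL H H hH hH]
  · intro H' hH' hne
    rw [Finset.mem_powersetCard] at hH'
    simp [evalₗ_apply, hL H' H hH'.2 hH, hne]
  · intro hH'
    simp [Finset.mem_powersetCard, hH] at hH'

/-- The vertices form an interpolation lattice of degree `d - N`. -/
theorem isInterpolationLattice (h : IsVertexMap n c θ) (hd : N ≤ d) :
    IsInterpolationLattice (d - N) (θ '' {H | H.card = N}) := by
  obtain ⟨L, hL⟩ := h.exists_eq_sum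
  refine fun f => ⟨_, Set.forall_mem_image.2 fun H hH => hL (fun H => f (θ H)) H hH, fun Q hQ => ?_⟩
  refine h.eq_of_evalAt_eq hd fun H hH => ?_
  rw [hL (fun H => f (θ H)) H hH]
  exact hQ _ ⟨H, hH, rfl⟩

/-- A sequence of polynomials that tends to zero pointwise tends to zero in every seminorm. -/
theorem tendsto_seminorm (h : IsVertexMap n c θ) (hd : N ≤ d) {P : ℕ → PolyLE N (d - N)}
    (hP : ∀ x, Tendsto (fun s => evalAt (P s) x) atTop (𝓝 0))
    (p : Seminorm ℝ (PolyLE N (d - N))) : Tendsto (fun s => p (P s)) atTop (𝓝 0) := by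
  obtain ⟨L, hL⟩ := h.exists_eq_sum
  -- The nodes are those of one fixed lattice, so the basis `L` is independent of `s` and finitely
  -- many values control `p`.
  have hle : ∀ s, p (P s) ≤
      ∑ H ∈ Finset.univ.powersetCard N, |evalAt (P s) (θ H)| * p (L H) := fun s => by
    have heq : P s = ∑ H ∈ Finset.univ.powersetCard N, evalAt (P s) (θ H) • L H :=
      h.eq_of_evalAt_eq hd fun H hH => (hL (fun H => evalAt (P s) (θ H)) H hH).symm
    conv_lhs => rw [heq]
    refine (Finset.le_sum_of_subadditive p (map_zero p).le (map_add_le_add p) _ _).trans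
      (Finset.sum_le_sum fun H _ => ?_)
    rw [map_smul_eq_mul, Real.norm_eq_abs]
  have hlim : Tendsto (fun s => ∑ H ∈ Finset.univ.powersetCard N, |evalAt (P s) (θ H)| * p (L H))
      atTop (𝓝 0) := by
    have := tendsto_finsetSum (Finset.univ.powersetCard N) fun H (_ : H ∈ _) =>
      ((hP (θ H)).abs.mul_const (p (L H)))
    simpa using this
  exact squeeze_zero (fun s => apply_nonneg p _) hle hlim

end IsVertexMap

end ChungYao

end

namespace ChungYao

/-! ### Taylor polynomial and error on a line of the arrangement -/

/-- The Taylor polynomial and the function have the same directional derivatives at the origin, up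
to the order of the polynomial. -/
theorem taylor_contDiffAt_and_iteratedFDeriv {N : ℕ} (m : ℕ) (f : E N → ℝ) :
    (∀ k : ℕ, ContDiffAt ℝ k (evalAt (taylor m f)) 0) ∧ ∀ k ≤ m, ∀ v : E N,
      iteratedFDeriv ℝ k (evalAt (taylor m f)) 0 (fun _ => v) =
        iteratedFDeriv ℝ k f 0 (fun _ => v) := by
  let p : FormalMultilinearSeries ℝ (E N) ℝ := fun k =>
    if k ≤ m then (k.factorial : ℝ)⁻¹ • iteratedFDeriv ℝ k f 0 else 0
  have hp : HasFiniteFPowerSeriesOnBall (evalAt (taylor m f)) p 0 (m + 1) ⊤ := by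
    refine .mk' (fun k hk => if_neg (by omega)) (by simp) fun y _ => ?_
    rw [zero_add, taylor_evalAt]
    refine Finset.sum_congr rfl fun k hk => ?_
    have hk' : k ≤ m := by simpa [Nat.lt_succ_iff] using hk
    simp [p, hk']
  have hp' := hp.toHasFPowerSeriesOnBall
  refine ⟨fun k => hp'.analyticAt.contDiffAt, fun k hk v => ?_⟩
  rw [← hp'.factorial_smul v k]
  have hk0 : (k.factorial : ℝ) ≠ 0 := by positivity
  simp only [p, if_pos hk, _root_.smul_apply, smul_eq_mul, nsmul_eq_mul]
  rw [mul_inv_cancel_left₀ hk0]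

namespace IsVertexMap

variable {N d : ℕ}

/-- The line through `θ (insert a K)` meets the hyperplane of index `i` at `θ (insert i K)`. -/
theorem line_eq_vertex {n : Fin d → E N} {c : Fin d → ℝ} {θ : Finset (Fin d) → E N}
    (h : IsVertexMap n c θ) {K : Finset (Fin d)} (hK : K.card + 1 = N) {v : E N}
    (hv : ∀ i ∈ K, inner ℝ (n i) v = 0) {a i : Fin d} (ha : a ∉ K) (hi : i ∉ K) {t : ℝ}
    (ht : inner ℝ (n i) (θ (insert a K)) - c i = -t * inner ℝ (n i) v) :
    θ (insert a K) + t • v = θ (insert i K) := by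
  rw [← h.mem_iff _ (by rw [Finset.card_insert_of_notMem hi, hK])]
  intro j hj
  rw [inner_add_right, inner_smul_right]
  rcases Finset.mem_insert.1 hj with rfl | hj
  · linarith
  · rw [hv j hj, mul_zero, add_zero]
    exact h.apply_eq_zero (by rw [Finset.card_insert_of_notMem ha, hK])
      (Finset.mem_insert_of_mem hj)

open Polynomial in
/-- The interpolation error of the lattice of a subfamily `S` at a vertex on one of its lines. -/
theorem abs_sub_evalAt_le {n : Fin d → E N} {c : Fin d → ℝ} {θ : Finset (Fin d) → E N}
    (h : IsVertexMap n c θ) (hn : ∀ i, ‖n i‖ = 1) {δ : ℝ} (hδ : 0 < δ)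
    (hvol : ∀ i : Fin N → Fin d, StrictMono i →
      δ ≤ (volume : Measure (E N)).real (parallelepiped (fun k => n (i k))))
    {k : ℕ} {S K : Finset (Fin d)} (hS : S.card = N + k) (hKS : K ⊆ S) (hK : K.card + 1 = N)
    {a : Fin d} (ha : a ∉ S) {U : Set (E N)} (hU : Convex ℝ U)
    (hθU : ∀ H : Finset (Fin d), H.card = N → θ H ∈ U) {g : E N → ℝ}
    (hg : ∀ y ∈ U, ContDiffAt ℝ (k + 1 : ℕ) g y) {B : ℝ}
    (hB : ∀ y ∈ U, ∀ v : E N, ‖v‖ ≤ 1 → |iteratedFDeriv ℝ (k + 1) g y (fun _ => v)| ≤ B)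
    (P : PolyLE N k)
    (hP : ∀ H : Finset (Fin d), H ⊆ S → H.card = N → evalAt P (θ H) = g (θ H)) :
    |g (θ (insert a K)) - evalAt P (θ (insert a K))| ≤
      B / δ ^ (k + 1) * |∏ i ∈ S \ K, (inner ℝ (n i) (θ (insert a K)) - c i)| := by
  classical
  obtain ⟨v, hv1, hv0, hvδ⟩ := exists_direction hn hvol K hK
  have haK : a ∉ K := fun h' => ha (hKS h')
  have haN : (insert a K).card = N := by rw [Finset.card_insert_of_notMem haK, hK]
  set x := θ (insert a K)
  -- Parameter at which the line `x + τ • v` meets the hyperplane `i`.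
  let t : Fin d → ℝ := fun i => -(inner ℝ (n i) x - c i) / inner ℝ (n i) v
  have hiv : ∀ i ∉ K, inner ℝ (n i) v ≠ 0 := fun i hi h0 => by
    have := hvδ i hi
    rw [h0, abs_zero] at this
    linarith
  have ht : ∀ i ∉ K, inner ℝ (n i) x - c i = -t i * inner ℝ (n i) v := fun i hi => by
    simp only [t]
    field_simp [hiv i hi]
  have hline : ∀ i ∉ K, x + t i • v = θ (insert i K) := fun i hi =>
    h.line_eq_vertex hK hv0 haK hi (ht i hi)
  have hSK : ∀ i ∈ S \ K, i ∈ S ∧ i ∉ K := fun i hi => Finset.mem_sdiff.1 hi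
  -- Equal parameters would put the vertex of `insert i K` on the hyperplane `j`.
  have hinj : Set.InjOn t (S \ K : Finset (Fin d)) := by
    intro i hi j hj hij
    have hi' := (hSK i hi).2
    have hj' := (hSK j hj).2
    by_contra hne
    have hij' : θ (insert i K) = θ (insert j K) := by rw [← hline i hi', ← hline j hj', hij]
    refine h.ne_zero (insert i K) (by rw [Finset.card_insert_of_notMem hi', hK]) j ?_ ?_
    · simp [Ne.symm hne, hj']
    · rw [hij']
      exact h.apply_eq_zero (by rw [Finset.card_insert_of_notMem hj', hK])
        (Finset.mem_insert_self _ _)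
  have hcard : (S \ K).card = k + 1 := by
    rw [Finset.card_sdiff_of_subset hKS]
    omega
  let I : Set ℝ := {τ | x + τ • v ∈ U}
  have hI : I.OrdConnected := by
    have : Convex ℝ I := fun τ hτ σ hσ p q hp hq hpq => by
      have := hU hτ hσ hp hq hpq
      change x + (p • τ + q • σ) • v ∈ U
      convert this using 1
      rw [smul_add, smul_add, add_add_add_comm, ← add_smul, hpq, one_smul, add_smul, smul_assoc,
        smul_assoc]
    exact this.ordConnected
  -- Restriction of `P` to the line.
  let q : ℝ[X] := MvPolynomial.aeval (fun i => C (v i) * X + C (x i)) (P : MvPolynomial (Fin N) ℝ)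
  have hq : ∀ τ, q.eval τ = evalAt P (x + τ • v) := by
    intro τ
    simp only [q, evalAt, MvPolynomial.aeval_def, MvPolynomial.polynomial_eval_eval₂,
      MvPolynomial.eval]
    rw [MvPolynomial.coe_eval₂Hom]
    congr 1
    · ext r; simp
    · funext i; simp; ring
  have hqdeg : q.natDegree < k + 1 := by
    have := MvPolynomial.aeval_natDegree_le (P : MvPolynomial (Fin N) ℝ)
      ((MvPolynomial.mem_restrictTotalDegree _ _ _).1 P.2) (fun i => C (v i) * X + C (x i))
      (n := 1) (fun i => natDegree_linear_le)
    simp only [q]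
    omega
  obtain ⟨ξ, hξ, herr⟩ := exists_interpolation_error hI (k + 1)
    (fun j τ => iteratedFDeriv ℝ j g (x + τ • v) (fun _ => v))
    (fun j hj τ hτ => hasDerivAt_iteratedFDeriv_line hj (hg _ hτ))
    ((S \ K).image t) (by rw [Finset.card_image_of_injOn hinj, hcard])
    (by
      simp only [Finset.forall_mem_image]
      intro i hi
      have hi' := (hSK i hi).2
      change x + t i • v ∈ U
      rw [hline i hi']
      exact hθU _ (by rw [Finset.card_insert_of_notMem hi', hK]))
    (by simpa [I] using hθU _ haN)
    (by
      intro h0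
      obtain ⟨i, hi, hi0⟩ := Finset.mem_image.1 h0
      have := ht i (hSK i hi).2
      rw [hi0, neg_zero, zero_mul] at this
      refine h.ne_zero _ haN i ?_ this
      simp [(hSK i hi).2, ne_of_mem_of_not_mem (hSK i hi).1 ha])
    q hqdeg
    (by
      simp only [Finset.forall_mem_image]
      intro i hi
      have hi' := (hSK i hi).2
      rw [hq, hline i hi', hP _ (Finset.insert_subset (hSK i hi).1 hKS)
        (by rw [Finset.card_insert_of_notMem hi', hK])]
      simp)
  -- Each form at `x` is `-t i` times a slope of size at least `δ`.
  have hprod : δ ^ (k + 1) * |∏ z ∈ (S \ K).image t, (-z)| ≤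
      |∏ i ∈ S \ K, (inner ℝ (n i) x - c i)| := by
    rw [Finset.prod_image hinj, Finset.prod_congr rfl fun i hi => ht i (hSK i hi).2,
      Finset.prod_mul_distrib, abs_mul, mul_comm]
    refine mul_le_mul_of_nonneg_left ?_ (abs_nonneg _)
    rw [Finset.abs_prod, ← hcard, ← Finset.prod_const]
    exact Finset.prod_le_prod (fun _ _ => hδ.le) fun i hi => hvδ i (hSK i hi).2
  have hBξ := hB _ hξ v hv1
  have hB0 : 0 ≤ B := (abs_nonneg _).trans hBξ
  simp only [hq, zero_smul, add_zero, iteratedFDeriv_zero_apply] at herr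
  rw [herr, abs_mul]
  calc _ ≤ B * |∏ z ∈ (S \ K).image t, (-z)| := by
        refine mul_le_mul_of_nonneg_right ?_ (abs_nonneg _)
        rw [abs_div, Nat.abs_cast]
        refine (div_le_self (abs_nonneg _) ?_).trans hBξ
        exact_mod_cast Nat.one_le_iff_ne_zero.2 (Nat.factorial_ne_zero _)
    _ = B / δ ^ (k + 1) * (δ ^ (k + 1) * |∏ z ∈ (S \ K).image t, (-z)|) := by
        field_simp
    _ ≤ _ := mul_le_mul_of_nonneg_left hprod (by positivity)

/-! ### Newton corrections and convergence to zero -/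

/-- **Newton's construction**: a polynomial interpolating at the vertices of a subfamily `S` is
corrected into one that interpolates at the vertices of `insert a S`. -/
theorem newton_evalAt_eq {n : Fin d → E N} {c : Fin d → ℝ} {θ : Finset (Fin d) → E N}
    (h : IsVertexMap n c θ) (hN : 0 < N) {S : Finset (Fin d)} {a : Fin d} (ha : a ∉ S)
    {g Q : E N → ℝ}
    (hQ : ∀ H : Finset (Fin d), H ⊆ S → H.card = N → Q (θ H) = g (θ H))
    {H : Finset (Fin d)} (hH : H ⊆ insert a S) (hHN : H.card = N) :
    Q (θ H) + ∑ K ∈ S.powersetCard (N - 1),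
      (g (θ (insert a K)) - Q (θ (insert a K))) /
        (∏ i ∈ S \ K, (inner ℝ (n i) (θ (insert a K)) - c i)) *
          ∏ i ∈ S \ K, (inner ℝ (n i) (θ H) - c i) = g (θ H) := by
  classical
  by_cases haH : a ∈ H
  · have hsub : H.erase a ⊆ S := by
      intro i hi
      have hi' := Finset.mem_erase.1 hi
      exact (Finset.mem_insert.1 (hH hi'.2)).resolve_left hi'.1
    have hcard : (H.erase a).card = N - 1 := by rw [Finset.card_erase_of_mem haH, hHN]
    -- Only the line through this vertex cut out by hyperplanes of `S` contributes: any other `K`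
    -- misses some `i ∈ H.erase a`, whose form vanishes here.
    rw [Finset.sum_eq_single (H.erase a)]
    · rw [Finset.insert_erase haH, div_mul_cancel₀]
      · ring
      · refine h.prod_ne_zero hHN ?_
        rw [Finset.disjoint_left]
        intro i hi hiH
        rw [Finset.mem_sdiff, Finset.mem_erase] at hi
        exact hi.2 ⟨ne_of_mem_of_not_mem hi.1 ha, hiH⟩
    · intro K hK hne
      rw [Finset.mem_powersetCard] at hK
      obtain ⟨i, hi, hiK⟩ : ∃ i ∈ H.erase a, i ∉ K := by
        by_contra! hs
        exact hne (Finset.eq_of_subset_of_card_le hs (by omega)).symm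
      rw [h.prod_eq_zero hHN (Finset.mem_of_mem_erase hi) (Finset.mem_sdiff.2 ⟨hsub hi, hiK⟩),
        mul_zero]
    · intro hno
      exact absurd (Finset.mem_powersetCard.2 ⟨hsub, hcard⟩) hno
  · have hsub : H ⊆ S := (Finset.subset_insert_iff_of_notMem haH).1 hH
    rw [Finset.sum_eq_zero, add_zero, hQ H hsub hHN]
    intro K hK
    rw [Finset.mem_powersetCard] at hK
    -- `K` has only `N - 1` elements, so every correction vanishes at the old vertices.
    obtain ⟨i, hi, hiK⟩ : ∃ i ∈ H, i ∉ K := by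
      by_contra! hs
      have := Finset.card_le_card (show H ⊆ K from hs)
      omega
    rw [h.prod_eq_zero hHN hi (Finset.mem_sdiff.2 ⟨hsub hi, hiK⟩), mul_zero]

/-- If the vertices tend to the origin and the derivatives of `g` up to the order `m` vanish there,
the interpolants of `g` tend to zero. -/
theorem exists_tendsto_zero (hN : 0 < N) {n : ℕ → Fin d → E N} {c : ℕ → Fin d → ℝ}
    {θ : ℕ → Finset (Fin d) → E N} (h : ∀ s, IsVertexMap (n s) (c s) (θ s))
    (hn : ∀ s i, ‖n s i‖ = 1) {δ : ℝ} (hδ : 0 < δ)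
    (hvol : ∀ s, ∀ i : Fin N → Fin d, StrictMono i →
      δ ≤ (volume : Measure (E N)).real (parallelepiped (fun k => n s (i k))))
    (hθ : ∀ H : Finset (Fin d), H.card = N → Tendsto (fun s => θ s H) atTop (𝓝 0))
    {m : ℕ} {g : E N → ℝ} (hg : ContDiffAt ℝ m g 0)
    (hg0 : ∀ k ≤ m, ∀ v : E N, iteratedFDeriv ℝ k g 0 (fun _ => v) = 0)
    (k : ℕ) (hk : k ≤ m) (S : Finset (Fin d)) (hS : S.card = N + k) :
    ∃ P : ℕ → PolyLE N k,
      (∀ s, ∀ H : Finset (Fin d), H ⊆ S → H.card = N → evalAt (P s) (θ s H) = g (θ s H)) ∧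
      ∀ x, Tendsto (fun s => evalAt (P s) x) atTop (𝓝 0) := by
  classical
  induction k generalizing S with
  | zero =>
    -- With `N` hyperplanes there is a single vertex, and the interpolant is constant.
    refine ⟨fun s => ⟨MvPolynomial.C (g (θ s S)), ?_⟩, fun s H hH hHN => ?_, fun x => ?_⟩
    · rw [MvPolynomial.mem_restrictTotalDegree, MvPolynomial.totalDegree_C]
    · rw [Finset.eq_of_subset_of_card_le hH (by omega)]
      simp [evalAt]
    · have h0 : g 0 = 0 := by simpa using hg0 0 (Nat.zero_le _) 0
      have := hg.continuousAt.tendsto.comp (hθ S (by simpa using hS))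
      simpa [evalAt, h0, Function.comp_def] using this
  | succ k ih =>
    obtain ⟨a, haS⟩ := Finset.card_pos.1 (by omega : 0 < S.card)
    obtain ⟨S', ha, rfl⟩ : ∃ S' : Finset (Fin d), a ∉ S' ∧ S = insert a S' :=
      ⟨S.erase a, Finset.notMem_erase a S, (Finset.insert_erase haS).symm⟩
    rw [Finset.card_insert_of_notMem ha] at hS
    have hS' : S'.card = N + k := by omega
    obtain ⟨Q, hQ, hQ0⟩ := ih (by omega) S' hS'
    have hmem : ∀ K ∈ S'.powersetCard (N - 1), K ⊆ S' ∧ K.card + 1 = N := fun K hK => by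
      have := Finset.mem_powersetCard.1 hK
      exact ⟨this.1, by omega⟩
    let γ : ℕ → Finset (Fin d) → ℝ := fun s K =>
      (g (θ s (insert a K)) - evalAt (Q s) (θ s (insert a K))) /
        (∏ i ∈ S' \ K, (inner ℝ (n s i) (θ s (insert a K)) - c s i))
    have hγ : ∀ K ∈ S'.powersetCard (N - 1), Tendsto (fun s => γ s K) atTop (𝓝 0) := by
      intro K hK
      obtain ⟨hKS, hK1⟩ := hmem K hK
      rw [Metric.tendsto_nhds]
      intro η hη
      -- Chosen so that the error estimate gives `|γ s K| ≤ η / 2 < η`.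
      set B := η / 2 * δ ^ (k + 1) with hBdef
      have hBpos : 0 < B := by positivity
      have hnear : ∀ᶠ y in 𝓝 (0 : E N), ContDiffAt ℝ (m : ℕ) g y ∧
          ‖iteratedFDeriv ℝ (k + 1) g y - iteratedFDeriv ℝ (k + 1) g 0‖ < B := by
        refine (hg.eventually (by simp)).and ?_
        have hc := hg.continuousAt_iteratedFDeriv (k := k + 1) (by exact_mod_cast hk)
        have := Metric.tendsto_nhds.1 hc.tendsto B hBpos
        simpa only [dist_eq_norm] using this
      obtain ⟨r, hr, hball⟩ := Metric.eventually_nhds_iff_ball.1 hnear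
      have hev : ∀ᶠ s in atTop, ∀ H ∈ (Finset.univ : Finset (Fin d)).powersetCard N,
          θ s H ∈ Metric.ball (0 : E N) r := by
        rw [Filter.eventually_all_finset]
        intro H hH
        exact (hθ H (Finset.mem_powersetCard.1 hH).2).eventually (Metric.ball_mem_nhds _ hr)
      filter_upwards [hev] with s hs
      have hle := (h s).abs_sub_evalAt_le (hn s) hδ (hvol s) hS' hKS hK1 ha
        (convex_ball (0 : E N) r)
        (fun H hH => hs H (Finset.mem_powersetCard.2 ⟨Finset.subset_univ _, hH⟩))
        (g := g) (fun y hy => (hball y hy).1.of_le (by exact_mod_cast hk)) (B := B)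
        (fun y hy v hv => by
          have h1 := (iteratedFDeriv ℝ (k + 1) g y - iteratedFDeriv ℝ (k + 1) g 0).le_opNorm
            (fun _ => v)
          rw [_root_.sub_apply, hg0 (k + 1) hk, sub_zero,
            Real.norm_eq_abs] at h1
          refine h1.trans ?_
          rw [Finset.prod_const]
          calc _ ≤ B * 1 := mul_le_mul (hball y hy).2.le
                (pow_le_one₀ (norm_nonneg _) hv) (by positivity) hBpos.le
            _ = B := mul_one B)
        (Q s) (hQ s)
      rw [dist_zero_right, Real.norm_eq_abs, abs_div]
      have hB' : B / δ ^ (k + 1) = η / 2 := by rw [hBdef]; field_simp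
      rw [hB'] at hle
      exact (div_le_of_le_mul₀ (abs_nonneg _) (by positivity) hle).trans_lt (by linarith)
    have hdeg : ∀ s, (Q s : MvPolynomial (Fin N) ℝ) + ∑ K ∈ S'.powersetCard (N - 1),
        γ s K • formProd (n s) (c s) (S' \ K) ∈ PolyLE N (k + 1) := by
      intro s
      refine Submodule.add_mem _ ?_ (Submodule.sum_mem _ fun K hK =>
        Submodule.smul_mem _ _ (formProd_mem _ _ _ ?_))
      · rw [MvPolynomial.mem_restrictTotalDegree]
        exact ((MvPolynomial.mem_restrictTotalDegree _ _ _).1 (Q s).2).trans (Nat.le_succ k)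
      · obtain ⟨hKS, hK1⟩ := hmem K hK
        rw [Finset.card_sdiff_of_subset hKS]
        omega
    have heval : ∀ s x, evalAt (⟨_, hdeg s⟩ : PolyLE N (k + 1)) x = evalAt (Q s) x +
        ∑ K ∈ S'.powersetCard (N - 1), γ s K * ∏ i ∈ S' \ K, (inner ℝ (n s i) x - c s i) := by
      intro s x
      simp [evalAt, MvPolynomial.smul_eval, eval_formProd]
    refine ⟨fun s => ⟨_, hdeg s⟩, fun s H hH hHN => ?_, fun x => ?_⟩
    · rw [heval]
      exact (h s).newton_evalAt_eq hN ha (hQ s) hH hHN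
    · simp only [heval]
      -- A vertex `V i` on each hyperplane expresses `c s i` as an inner product. The forms at `x`
      -- then stay bounded as the vertices tend to the origin.
      have hvert : ∀ i : Fin d, ∃ H : Finset (Fin d), i ∈ S' → i ∈ H ∧ H.card = N := fun i => by
        by_cases hi : i ∈ S'
        · obtain ⟨H, hiH, -, hH⟩ := Finset.exists_subsuperset_card_eq
            (Finset.singleton_subset_iff.2 hi) (n := N) (by rw [Finset.card_singleton]; omega) (by omega)
          exact ⟨H, fun _ => ⟨Finset.singleton_subset_iff.1 hiH, hH⟩⟩
        · exact ⟨∅, fun hi' => absurd hi' hi⟩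
      choose V hV using hvert
      have hfactor : ∀ s, ∀ i ∈ S', |inner ℝ (n s i) x - c s i| ≤ ‖x - θ s (V i)‖ := by
        intro s i hi
        have h0 := (h s).apply_eq_zero (hV i hi).2 (hV i hi).1
        have h1 := abs_real_inner_le_norm (n s i) (x - θ s (V i))
        rw [hn, one_mul, inner_sub_right] at h1
        rwa [show c s i = inner ℝ (n s i) (θ s (V i)) by linarith]
      have hterm : ∀ K ∈ S'.powersetCard (N - 1), Tendsto
          (fun s => γ s K * ∏ i ∈ S' \ K, (inner ℝ (n s i) x - c s i)) atTop (𝓝 0) := by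
        intro K hK
        have hlim : Tendsto (fun s => |γ s K| * ∏ i ∈ S' \ K, ‖x - θ s (V i)‖) atTop (𝓝 0) := by
          have := (hγ K hK).abs.mul (tendsto_finsetProd (S' \ K) fun i hi =>
            ((hθ (V i) (hV i (Finset.mem_sdiff.1 hi).1).2).const_sub x).norm)
          simpa using this
        refine squeeze_zero_norm (fun s => ?_) hlim
        rw [Real.norm_eq_abs, abs_mul, Finset.abs_prod]
        exact mul_le_mul_of_nonneg_left (Finset.prod_le_prod (fun _ _ => abs_nonneg _)
          fun i hi => hfactor s i (Finset.mem_sdiff.1 hi).1) (abs_nonneg _)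
      simpa using (hQ0 x).add (tendsto_finsetSum _ hterm)

end IsVertexMap

end ChungYao

/-! ### The limit theorem -/

/-- The limit of polynomials is taken in the finite-dimensional space of polynomials of degree at
most `d - N`, with respect to every seminorm and in particular every norm on it. The supremum in
`hC1` is the maximum over a finite nonempty set. -/
theorem theorem3p1 (N d : ℕ) (hN : 2 ≤ N) (hd : N ≤ d)
    (n : ℕ → Fin d → ChungYao.E N) (c : ℕ → Fin d → ℝ)
    (hn : ∀ s i, ‖n s i‖ = 1)
    (hH : ∀ s, ChungYao.InGeneralPosition (fun i => ChungYao.hyperplane (n s i) (c s i)))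
    (Θ : ℕ → Set (ChungYao.E N))
    (hΘ : ∀ s, Θ s = ChungYao.lattice (fun i => ChungYao.hyperplane (n s i) (c s i)))
    (hC1 : Tendsto (fun s => sSup ((fun θ : ChungYao.E N => ‖θ‖) '' Θ s)) atTop (𝓝 0))
    (hC2 : ∃ δ : ℝ, 0 < δ ∧ ∀ (s : ℕ) (i : Fin N → Fin d), StrictMono i →
      δ ≤ (volume : Measure (ChungYao.E N)).real (parallelepiped (fun k => n s (i k)))) :
    ∃ hL : ∀ s, ChungYao.IsInterpolationLattice (d - N) (Θ s),
      ∀ (f : ChungYao.E N → ℝ) (Ω : Set (ChungYao.E N)), Ω ∈ 𝓝 (0 : ChungYao.E N) →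
        ContDiffOn ℝ ((d - N + 1 : ℕ) : WithTop ℕ∞) f Ω →
        ∀ p : Seminorm ℝ (ChungYao.PolyLE N (d - N)),
          Tendsto (fun s => p (ChungYao.lagrange (hL s) f - ChungYao.taylor (d - N) f))
            atTop (𝓝 0) := by
  classical
  have hN0 : 0 < N := by omega
  obtain ⟨δ, hδ, hvol⟩ := hC2
  choose θ hθ hθ' using fun s => (hH s).exists_isVertexMap hN0
  have hΘθ : ∀ s, Θ s = θ s '' {H | H.card = N} := fun s => by
    rw [hΘ s, ChungYao.lattice_eq_image (hθ' s)]
  have hmem : ∀ s, ∀ H : Finset (Fin d), H.card = N → θ s H ∈ Θ s := fun s H hHN => by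
    rw [hΘθ s]
    exact ⟨H, hHN, rfl⟩
  have hlim : ∀ H : Finset (Fin d), H.card = N → Tendsto (fun s => θ s H) atTop (𝓝 0) := by
    intro H hHN
    refine squeeze_zero_norm (fun s => ?_) hC1
    have hfin : (Θ s).Finite := by
      rw [hΘθ s]
      exact (Set.toFinite _).image _
    exact le_csSup (hfin.image _).bddAbove ⟨_, hmem s H hHN, rfl⟩
  have hL : ∀ s, ChungYao.IsInterpolationLattice (d - N) (Θ s) := fun s => by
    rw [hΘθ s]
    exact (hθ s).isInterpolationLattice hd
  refine ⟨hL, fun f Ω hΩ hf p => ?_⟩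
  obtain ⟨hT, hTf⟩ := ChungYao.taylor_contDiffAt_and_iteratedFDeriv (d - N) f
  have hf0 : ContDiffAt ℝ (d - N : ℕ) f 0 :=
    (hf.contDiffAt hΩ).of_le (by exact_mod_cast Nat.le_succ _)
  obtain ⟨P, hP, hP0⟩ := ChungYao.IsVertexMap.exists_tendsto_zero hN0 hθ hn hδ hvol hlim
    (g := f - ChungYao.evalAt (ChungYao.taylor (d - N) f)) (hf0.sub (hT _))
    (fun k hk v => by
      rw [iteratedFDeriv_sub_apply (hf0.of_le (by exact_mod_cast hk)) (hT k), _root_.sub_apply,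
        hTf k hk v, sub_self])
    (d - N) le_rfl Finset.univ (by rw [Finset.card_fin]; omega)
  -- By uniqueness, the interpolant of `f` minus the Taylor polynomial is the interpolant of the
  -- difference.
  have heq : ∀ s, ChungYao.lagrange (hL s) f - ChungYao.taylor (d - N) f = P s := fun s => by
    refine (hθ s).eq_of_evalAt_eq hd fun H hHN => ?_
    rw [hP s H (Finset.subset_univ _) hHN, ← ChungYao.evalₗ_apply, map_sub, ChungYao.evalₗ_apply,
      ChungYao.evalₗ_apply, ChungYao.lagrange_evalAt (hL s) f (hmem s H hHN), Pi.sub_apply]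
  simp only [heq]
  exact (hθ 0).tendsto_seminorm hd hP0 p
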